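/- Let $X,Y,W\in\mathbb{R}[t]$ with $\gcd(X,Y,W)=1$ be such that $\phi(t)=\left(\frac{X(t)}{W(t)},\frac{Y(t)}{W(t)}\right)$ is a proper (i.e. birational onto its image) parametrization of a plane curve $\mathcal{C}$, and let $d>0$. Put $U=X'W-XW'$, $V=Y'W-YW'$, $\widehat{U}=U/\gcd(U,V)$, $\widehat{V}=V/\gcd(U,V)$. For real $t$ with $W(t)\neq 0$ and $(U(t),V(t))\neq(0,0)$, the two points $$\left(\frac{X(t)}{W(t)}\pm d\,\frac{V(t)}{\sqrt{U^2(t)+V^2(t)}},\ \frac{Y(t)}{W(t)}\mp d\,\frac{U(t)}{\sqrt{U^2(t)+V^2(t)}}\right)$$ are said to be generated by $t$. The offset $\mathcal{O}_d(\mathcal{C})\subset\mathbb{C}^2$ is the Zariski closure of the set of all points generated in this way, and it is assumed to be irreducible. A singularity of $\mathcal{O}_d(\mathcal{C})$ is a point of it at which both partial derivatives of its (reduced) implicit equation vanish; a real point of $\mathcal{O}_d(\mathcal{C})$ is non-isolated if it is the center of a real branch (a nonconstant real analytic local parametrization) of $\mathcal{O}_d(\mathcal{C})$. Let $P(x,y,t)$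 and $Q(x,y,t)$ be the quotients of $$U(t)\,(W(t)x-X(t))+V(t)\,(W(t)y-Y(t))\quad\text{and}\quad (W(t)x-X(t))^2+(W(t)y-Y(t))^2-d^2W^2(t)$$ by their $t$-contents, the $t$-content of a polynomial being the gcd in $\mathbb{R}[t]$ of its coefficients as a polynomial in $x,y$. Let $n=\deg_t P$, $m=\deg_t Q$, and let $\mathbf{sres}_1(x,y)\in\mathbb{R}[x,y]$ be the first principal subresultant coefficient of $P,Q$ with respect to $t$, that is, the coefficient of $t^1$ in the subresultant polynomial $\mathbf{Subres}_1(P,n,Q,m)$. Set $$x(t,\alpha)=\frac{X(t)}{W(t)}+d\,\frac{\widehat{V}(t)}{\alpha},\qquad y(t,\alpha)=\frac{Y(t)}{W(t)}-d\,\frac{\widehat{U}(t)}{\alpha}.$$ If $(x_0,y_0)$ is a non-isolated, real affine singularity of $\mathcal{O}_d(\mathcal{C})$ generated by $t_0\in\mathbb{R}$ with $(U(t_0),V(t_0))\neq(0,0)$, then there exists $\alpha_0\in\mathbb{R}$ with $\alpha_0^2=\widehat{U}^2(t_0)+\widehat{V}^2(t_0)$ such that $(x_0,y_0)=(x(t_0,\alpha_0),y(t_0,\alpha_0))$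 and $$\mathbf{sres}_1(x(t_0,\alpha_0),y(t_0,\alpha_0))=0.$$ -/

import Mathlib

noncomputable section

namespace OffsetCurve

/-! ### Subresultants -/

section Subresultants

variable {R : Type*} [CommRing R]

/-- The Sylvester matrix of index `i` of `f` (formal degree `n`) and `g` (formal degree `m`), of
size `(n + m - 2 i) × (n + m - i)`: first `m - i` shifted rows of coefficients of `f`, written
from degree `n` downwards, then `n - i` shifted rows of coefficients of `g`. -/
def sylv (i : ℕ) (f : Polynomial R) (n : ℕ) (g : Polynomial R) (m : ℕ) :
    Matrix (Fin (n + m - 2 * i)) (Fin (n + m - i)) R :=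
  Matrix.of fun r c =>
    if (r : ℕ) < m - i then
      if (r : ℕ) ≤ c ∧ (c : ℕ) ≤ r + n then f.coeff (r + n - c) else 0
    else
      if (r : ℕ) - (m - i) ≤ c ∧ (c : ℕ) ≤ (r - (m - i)) + m then
        g.coeff ((r - (m - i)) + m - c) else 0

/-- The square submatrix of a `p × q` matrix formed by its first `p - 1` columns and its
`(k + p)`-th column (columns counted from `1`), for `0 ≤ k ≤ q - p`. -/
def detpolMinor {p q : ℕ} (h : p ≤ q) (D : Matrix (Fin p) (Fin q) R) (k : Fin (q - p + 1)) :
    Matrix (Fin p) (Fin p) R :=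
  Matrix.of fun r j =>
    if (j : ℕ) + 1 < p then D r ⟨j, j.isLt.trans_le h⟩
    else D r ⟨(k : ℕ) + (p - 1), by have := j.isLt; have := k.isLt; omega⟩

/-- The determinant polynomial of a `p × q` matrix, `p ≤ q`. -/
def detpol {p q : ℕ} (h : p ≤ q) (D : Matrix (Fin p) (Fin q) R) : Polynomial R :=
  ∑ k : Fin (q - p + 1), Polynomial.C (detpolMinor h D k).det * Polynomial.X ^ (q - p - (k : ℕ))

/-- The `i`-th subresultant polynomial (meaningful for `i < min n m`). -/
def subres (i : ℕ) (f : Polynomial R) (n : ℕ) (g : Polynomial R) (m : ℕ) : Polynomial R :=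
  detpol (by omega) (sylv i f n g m)

/-- The `i`-th principal subresultant coefficient. -/
def sres (i : ℕ) (f : Polynomial R) (n : ℕ) (g : Polynomial R) (m : ℕ) : R :=
  (subres i f n g m).coeff i

end Subresultants

/-! ### Plane algebraic curves in `ℂ²` and their real points -/

/-- A real point of the plane, seen in `ℂ²`. -/
def toC (p : ℝ × ℝ) : Fin 2 → ℂ := ![(p.1 : ℂ), (p.2 : ℂ)]

/-- The Zariski closure in `ℂ²`. -/
def zariskiClosure (S : Set (Fin 2 → ℂ)) : Set (Fin 2 → ℂ) :=
  MvPolynomial.zeroLocus ℂ (MvPolynomial.vanishingIdeal ℂ S)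

/-- An algebraic set is irreducible when its vanishing ideal is prime. -/
def IsIrreducibleCurve (D : Set (Fin 2 → ℂ)) : Prop :=
  (MvPolynomial.vanishingIdeal ℂ D).IsPrime

/-- `F = 0` is the (reduced) implicit equation of `D`: the polynomials vanishing on `D` are the
multiples of `F`. -/
def IsImplicitEquation (F : MvPolynomial (Fin 2) ℂ) (D : Set (Fin 2 → ℂ)) : Prop :=
  MvPolynomial.vanishingIdeal ℂ D = Ideal.span {F}

/-- `S` is an affine singularity of `D`: a point of `D` at which both partial derivatives of the
implicit equation of `D` vanish. -/
def IsSingularity (D : Set (Fin 2 → ℂ)) (S : Fin 2 → ℂ) : Prop :=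
  S ∈ D ∧ ∃ F, IsImplicitEquation F D ∧ ∀ i, MvPolynomial.eval S (MvPolynomial.pderiv i F) = 0

/-- The real point `p` is a non-isolated point of `D`: it is the centre of a real place (real
branch) of `D`, that is, of a nonconstant real analytic local parametrization. -/
def IsNonIsolated (D : Set (Fin 2 → ℂ)) (p : ℝ × ℝ) : Prop :=
  ∃ γ : ℝ → ℝ × ℝ, AnalyticAt ℝ γ 0 ∧ γ 0 = p ∧
    (¬ ∀ᶠ h in nhds (0 : ℝ), γ h = p) ∧ ∀ᶠ h in nhds (0 : ℝ), toC (γ h) ∈ D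

/-! ### The parametrization `(X / W, Y / W)` and its offset at distance `d` -/

/-- `(X / W, Y / W)` is proper, i.e. birational onto its image: `X / W` and `Y / W` generate the
field `ℝ(t)`. -/
def IsProper (X Y W : Polynomial ℝ) : Prop :=
  IntermediateField.adjoin ℝ
    ({algebraMap (Polynomial ℝ) (RatFunc ℝ) X / algebraMap (Polynomial ℝ) (RatFunc ℝ) W,
      algebraMap (Polynomial ℝ) (RatFunc ℝ) Y / algebraMap (Polynomial ℝ) (RatFunc ℝ) W} :
        Set (RatFunc ℝ)) = ⊤

/-- `U = X' W - X W'`; the polynomial `V` is `velocity Y W`. -/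
def velocity (X W : Polynomial ℝ) : Polynomial ℝ :=
  X.derivative * W - X * W.derivative

/-- `U / gcd (U, V)`. -/
def hatU (X Y W : Polynomial ℝ) : Polynomial ℝ :=
  velocity X W / EuclideanDomain.gcd (velocity X W) (velocity Y W)

/-- `V / gcd (U, V)`. -/
def hatV (X Y W : Polynomial ℝ) : Polynomial ℝ :=
  velocity Y W / EuclideanDomain.gcd (velocity X W) (velocity Y W)

/-- The two points `φ_d(t)`: `s = 1` for the exterior offset, `s = -1` for the interior one. The
formula is meaningful for `W(t) ≠ 0` and `(U(t), V(t)) ≠ (0, 0)`. -/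
def offsetPoint (X Y W : Polynomial ℝ) (d s t : ℝ) : ℝ × ℝ :=
  (X.eval t / W.eval t + s * d * ((velocity Y W).eval t /
      √((velocity X W).eval t ^ 2 + (velocity Y W).eval t ^ 2)),
   Y.eval t / W.eval t - s * d * ((velocity X W).eval t /
      √((velocity X W).eval t ^ 2 + (velocity Y W).eval t ^ 2)))

/-- `p` is generated by the real parameter value `t` with `(U(t), V(t)) ≠ (0, 0)`. -/
def GeneratedByRegular (X Y W : Polynomial ℝ) (d : ℝ) (p : ℝ × ℝ) (t : ℝ) : Prop :=
  W.eval t ≠ 0 ∧ ((velocity X W).eval t, (velocity Y W).eval t) ≠ (0, 0) ∧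
    (p = offsetPoint X Y W d 1 t ∨ p = offsetPoint X Y W d (-1) t)

/-- The offset curve: the Zariski closure of the set of points `φ_d(t)`, `t` real. -/
def offset (X Y W : Polynomial ℝ) (d : ℝ) : Set (Fin 2 → ℂ) :=
  zariskiClosure (toC '' {p | ∃ t, GeneratedByRegular X Y W d p t})

/-- `x(t, α) = X(t) / W(t) + d V̂(t) / α`. -/
def xMap (X Y W : Polynomial ℝ) (d t α : ℝ) : ℝ :=
  X.eval t / W.eval t + d * ((hatV X Y W).eval t / α)

/-- `y(t, α) = Y(t) / W(t) - d Û(t) / α`. -/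
def yMap (X Y W : Polynomial ℝ) (d t α : ℝ) : ℝ :=
  Y.eval t / W.eval t - d * ((hatU X Y W).eval t / α)

/-! ### The polynomials `P` and `Q`, in `ℝ[x, y][t]` -/

/-- A polynomial in `t`, seen in `ℝ[x, y][t]`. -/
def inT (f : Polynomial ℝ) : Polynomial (MvPolynomial (Fin 2) ℝ) :=
  f.map MvPolynomial.C

/-- The variable `x` (for `i = 0`) or `y` (for `i = 1`) of `ℝ[x, y][t]`. -/
def xy (i : Fin 2) : Polynomial (MvPolynomial (Fin 2) ℝ) :=
  Polynomial.C (MvPolynomial.X i)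

/-- `U (W x - X) + V (W y - Y)`. -/
def tildeP (X Y W : Polynomial ℝ) : Polynomial (MvPolynomial (Fin 2) ℝ) :=
  inT (velocity X W) * (inT W * xy 0 - inT X) + inT (velocity Y W) * (inT W * xy 1 - inT Y)

/-- `(W x - X)² + (W y - Y)² - d² W²`. -/
def tildeQ (X Y W : Polynomial ℝ) (d : ℝ) : Polynomial (MvPolynomial (Fin 2) ℝ) :=
  (inT W * xy 0 - inT X) ^ 2 + (inT W * xy 1 - inT Y) ^ 2 - inT (Polynomial.C (d ^ 2) * W ^ 2)

/-- The `t`-content of `tildeP`: the gcd in `ℝ[t]` of its coefficients `U W`, `V W` and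
`-(U X + V Y)` as a polynomial in `x, y`. -/
def contentP (X Y W : Polynomial ℝ) : Polynomial ℝ :=
  EuclideanDomain.gcd (velocity X W * W)
    (EuclideanDomain.gcd (velocity Y W * W) (velocity X W * X + velocity Y W * Y))

/-- The `t`-content of `tildeQ`: the gcd in `ℝ[t]` of its coefficients `W²` (twice), `-2 W X`,
`-2 W Y` and `X² + Y² - d² W²` as a polynomial in `x, y`. -/
def contentQ (X Y W : Polynomial ℝ) (d : ℝ) : Polynomial ℝ :=
  EuclideanDomain.gcd (W ^ 2) (EuclideanDomain.gcd (W * X) (EuclideanDomain.gcd (W * Y)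
    (X ^ 2 + Y ^ 2 - Polynomial.C (d ^ 2) * W ^ 2)))

/-- `P`, the quotient of `tildeP` by its `t`-content, written coefficient by coefficient. -/
def polyP (X Y W : Polynomial ℝ) : Polynomial (MvPolynomial (Fin 2) ℝ) :=
  inT (velocity X W * W / contentP X Y W) * xy 0 +
    inT (velocity Y W * W / contentP X Y W) * xy 1 -
    inT ((velocity X W * X + velocity Y W * Y) / contentP X Y W)

/-- `Q`, the quotient of `tildeQ` by its `t`-content, written coefficient by coefficient. -/
def polyQ (X Y W : Polynomial ℝ) (d : ℝ) : Polynomial (MvPolynomial (Fin 2) ℝ) :=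
  inT (W ^ 2 / contentQ X Y W d) * (xy 0 ^ 2 + xy 1 ^ 2) -
    2 * inT (W * X / contentQ X Y W d) * xy 0 - 2 * inT (W * Y / contentQ X Y W d) * xy 1 +
    inT ((X ^ 2 + Y ^ 2 - Polynomial.C (d ^ 2) * W ^ 2) / contentQ X Y W d)

theorem inT_mul_div {a b : Polynomial ℝ} (h : b ∣ a) : inT b * inT (a / b) = inT a := by
  rw [inT, inT, ← Polynomial.map_mul, inT]
  congr 1
  by_cases hb : b = 0
  · subst hb
    rw [zero_mul, zero_dvd_iff.mp h]
  · exact EuclideanDomain.mul_div_cancel' hb h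

theorem tildeP_eq (X Y W : Polynomial ℝ) :
    tildeP X Y W = inT (contentP X Y W) * polyP X Y W := by
  have h1 : contentP X Y W ∣ velocity X W * W := EuclideanDomain.gcd_dvd_left _ _
  have h0 := EuclideanDomain.gcd_dvd_right (velocity X W * W)
    (EuclideanDomain.gcd (velocity Y W * W) (velocity X W * X + velocity Y W * Y))
  have h2 : contentP X Y W ∣ velocity Y W * W := h0.trans (EuclideanDomain.gcd_dvd_left _ _)
  have h3 : contentP X Y W ∣ velocity X W * X + velocity Y W * Y :=
    h0.trans (EuclideanDomain.gcd_dvd_right _ _)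
  have e1 := inT_mul_div h1
  have e2 := inT_mul_div h2
  have e3 := inT_mul_div h3
  have m1 : inT (velocity X W * W) = inT (velocity X W) * inT W := Polynomial.map_mul _
  have m2 : inT (velocity Y W * W) = inT (velocity Y W) * inT W := Polynomial.map_mul _
  have m3 : inT (velocity X W * X + velocity Y W * Y) =
      inT (velocity X W) * inT X + inT (velocity Y W) * inT Y := by simp [inT]
  rw [tildeP, polyP]
  linear_combination -(xy 0) * (e1 + m1) - xy 1 * (e2 + m2) + (e3 + m3)

theorem tildeQ_eq (X Y W : Polynomial ℝ) (d : ℝ) :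
    tildeQ X Y W d = inT (contentQ X Y W d) * polyQ X Y W d := by
  have h1 : contentQ X Y W d ∣ W ^ 2 := EuclideanDomain.gcd_dvd_left _ _
  have h0 := EuclideanDomain.gcd_dvd_right (W ^ 2) (EuclideanDomain.gcd (W * X)
    (EuclideanDomain.gcd (W * Y) (X ^ 2 + Y ^ 2 - Polynomial.C (d ^ 2) * W ^ 2)))
  have h2 : contentQ X Y W d ∣ W * X := h0.trans (EuclideanDomain.gcd_dvd_left _ _)
  have h0' := h0.trans (EuclideanDomain.gcd_dvd_right _ _)
  have h3 : contentQ X Y W d ∣ W * Y := h0'.trans (EuclideanDomain.gcd_dvd_left _ _)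
  have h4 : contentQ X Y W d ∣ X ^ 2 + Y ^ 2 - Polynomial.C (d ^ 2) * W ^ 2 :=
    h0'.trans (EuclideanDomain.gcd_dvd_right _ _)
  have e1 := inT_mul_div h1
  have e2 := inT_mul_div h2
  have e3 := inT_mul_div h3
  have e4 := inT_mul_div h4
  have m1 : inT (W ^ 2) = inT W ^ 2 := Polynomial.map_pow _ _
  have m2 : inT (W * X) = inT W * inT X := Polynomial.map_mul _
  have m3 : inT (W * Y) = inT W * inT Y := Polynomial.map_mul _
  have m4 : inT (X ^ 2 + Y ^ 2 - Polynomial.C (d ^ 2) * W ^ 2) =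
      inT X ^ 2 + inT Y ^ 2 - inT (Polynomial.C (d ^ 2) * W ^ 2) := by simp [inT]
  rw [tildeQ, polyQ]
  linear_combination -(xy 0 ^ 2 + xy 1 ^ 2) * (e1 + m1) + 2 * xy 0 * (e2 + m2) +
    2 * xy 1 * (e3 + m3) - (e4 + m4)

/-- The first principal subresultant coefficient of `P` and `Q` with respect to `t`, a polynomial
in `x, y`. -/
def sresPQ (X Y W : Polynomial ℝ) (d : ℝ) : MvPolynomial (Fin 2) ℝ :=
  sres 1 (polyP X Y W) (polyP X Y W).natDegree (polyQ X Y W d) (polyQ X Y W d).natDegree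

end OffsetCurve

end

/-!
Write `s₁ t + s₀`, with `s₁ = sres₁`, for the first subresultant of `P` and `Q`. Evaluated at a
point `(x, y)` it vanishes at every common root `t` of `P(x, y, ·)` and `Q(x, y, ·)`
(`eval₂_subres_eq_zero`): these are the values of `t` whose powers are annihilated by all rows of
the Sylvester matrix. So where `s₁ ≠ 0`, the parameter of a generated point is the regular function
`-s₀ / s₁` of the point, and clearing denominators in `P(x, y, -s₀ / s₁)` gives a polynomial in
`x, y` alone which vanishes on the offset; likewise for `Q`.

At a singular point `S` every polynomial vanishing on the offset has zero gradient
(`eval_eq_zero_and_pderiv_eq_zero_of_isSingularity`). Suppose `S` is generated by `t₀` and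
`s₁(S) ≠ 0`. Choose a direction `v ≠ 0` along which `s₁ t₀ + s₀` has derivative zero. Over the dual
numbers, at the infinitesimally near point `S + ε v`, the function `-s₀ / s₁` is the constant `t₀`,
hence `P` and `Q` vanish at `(S + ε v, t₀)`. The coefficient of `ε` says that `v` is orthogonal to
`(U, V)(t₀)` and to the direction from `φ(t₀)` to `S`, which is that of `(V, -U)(t₀)`. These two
span the plane, so `v = 0`, a contradiction.

The subresultant is available only if `n + m ≥ 3`. In fact `n ≥ 1`, for otherwise all normals of the
curve coincide, and `m ≥ 2`, for otherwise the equation of the circles of radius `d`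
centred on the curve has degree at most one in `t`, and the curve is a point
(`natDegree_polyP_pos`, `two_le_natDegree_polyQ`). In both cases `U = V = 0`.
-/

namespace OffsetCurve

/-! ### Subresultants at a common root -/

section Subresultants

variable {R S : Type*} [CommRing R] [CommRing S]

theorem natDegree_detpol_le {p q : ℕ} (h : p ≤ q) (D : Matrix (Fin p) (Fin q) R) :
    (detpol h D).natDegree ≤ q - p :=
  Polynomial.natDegree_sum_le_of_forall_le _ _ fun _ _ =>
    (Polynomial.natDegree_C_mul_X_pow_le _ _).trans (Nat.sub_le _ _)

theorem map_sylv (φ : R →+* S) (i : ℕ) (f : Polynomial R) (n : ℕ) (g : Polynomial R) (m : ℕ) :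
    (sylv i f n g m).map φ = sylv i (f.map φ) n (g.map φ) m := by
  ext r c
  simp only [sylv, Matrix.map_apply, Matrix.of_apply, Polynomial.coeff_map]
  split_ifs <;> simp

theorem map_detpol (φ : R →+* S) {p q : ℕ} (h : p ≤ q) (D : Matrix (Fin p) (Fin q) R) :
    (detpol h D).map φ = detpol h (D.map φ) := by
  have key (k) : φ (detpolMinor h D k).det = (detpolMinor h (D.map φ) k).det := by
    rw [RingHom.map_det]
    congr 1
    ext r j
    simp only [RingHom.mapMatrix_apply, Matrix.map_apply, detpolMinor, Matrix.of_apply]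
    split_ifs <;> rfl
  simp [detpol, Polynomial.map_sum, key]

theorem map_subres (φ : R →+* S) (i : ℕ) (f : Polynomial R) (n : ℕ) (g : Polynomial R) (m : ℕ) :
    (subres i f n g m).map φ = subres i (f.map φ) n (g.map φ) m := by
  rw [subres, subres, map_detpol, map_sylv]

/-- If the rows of `D`, read as polynomials, vanish at `t`, then so does the determinant polynomial:
its value at `t` is the determinant of a square matrix whose kernel contains a vector with a
coordinate equal to one. -/
theorem eval_detpol_eq_zero {p q : ℕ} (h : p ≤ q) (hp : 0 < p) (D : Matrix (Fin p) (Fin q) R)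
    (t : R) (hD : ∀ r, ∑ c : Fin q, D r c * t ^ (q - 1 - (c : ℕ)) = 0) :
    (detpol h D).eval t = 0 := by
  obtain ⟨a, rfl⟩ : ∃ a, p = a + 1 := ⟨p - 1, by omega⟩
  obtain ⟨s, rfl⟩ : ∃ s, q = a + (s + 1) := ⟨q - (a + 1), by omega⟩
  have hs : a + (s + 1) - (a + 1) + 1 = s + 1 := by omega
  -- the last columns of the minors, as a function of the index of the minor
  let u : Fin (s + 1) → Fin (a + 1) → R := fun k r => D r (Fin.natAdd a k)
  let B : Matrix (Fin (a + 1)) (Fin (a + 1)) R := detpolMinor h D 0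
  have hminor (k : Fin (s + 1)) :
      detpolMinor h D (finCongr hs.symm k) = B.updateCol (Fin.last a) (u k) := by
    ext r j
    induction j using Fin.lastCases with
    | last =>
      simp only [Matrix.updateCol_self, u, detpolMinor, Matrix.of_apply]
      rw [if_neg (by simp)]
      congr 1
      ext
      simp [add_comm]
    | cast j =>
      rw [Matrix.updateCol_ne (Fin.castSucc_lt_last j).ne]
      simp [B, detpolMinor]
  let N : Matrix (Fin (a + 1)) (Fin (a + 1)) R :=
    B.updateCol (Fin.last a) (∑ k : Fin (s + 1), t ^ (s - (k : ℕ)) • u k)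
  have hN : (detpol h D).eval t = N.det := by
    rw [← Matrix.cramer_apply, map_sum, Finset.sum_apply, detpol, Polynomial.eval_finsetSum,
      ← Equiv.sum_comp (finCongr hs.symm)]
    refine Finset.sum_congr rfl fun k _ => ?_
    rw [hminor, map_smul, Pi.smul_apply, Matrix.cramer_apply]
    have : a + (s + 1) - (a + 1) - (k : ℕ) = s - k := by omega
    rw [Polynomial.eval_mul, Polynomial.eval_C, Polynomial.eval_pow, Polynomial.eval_X,
      finCongr_apply, Fin.val_cast, this, smul_eq_mul, mul_comm]
  let w : Fin (a + 1) → R := Fin.snoc (fun j : Fin a => t ^ (a + s - (j : ℕ))) 1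
  have hNw : N.mulVec w = 0 := by
    ext r
    have := hD r
    rw [Fin.sum_univ_add] at this
    rw [Pi.zero_apply, ← this, Matrix.mulVec, dotProduct, Fin.sum_univ_castSucc]
    congr 1
    · refine Finset.sum_congr rfl fun j _ => ?_
      simp only [N, w, Fin.snoc_castSucc]
      rw [Matrix.updateCol_ne (Fin.castSucc_lt_last j).ne]
      simp only [B, detpolMinor, Matrix.of_apply, Fin.val_castSucc]
      rw [if_pos (by omega)]
      congr 1
    · simp only [N, w, Fin.snoc_last, Matrix.updateCol_self, mul_one, Finset.sum_apply,
        Pi.smul_apply, smul_eq_mul, u]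
      refine Finset.sum_congr rfl fun k _ => ?_
      rw [mul_comm, Fin.val_natAdd, show a + (s + 1) - 1 - (a + (k : ℕ)) = s - k by omega]
  have := congrArg (fun v => N.adjugate.mulVec v (Fin.last a)) hNw
  rw [hN]
  simpa [Matrix.mulVec_mulVec, Matrix.adjugate_mul, Matrix.smul_mulVec, w] using this

/-- A row of shifted coefficients of `f`, read as a polynomial, is a power of the variable
times `f`. -/
theorem sum_shifted_coeff {f : Polynomial R} {n r q : ℕ} (hf : f.natDegree ≤ n) (hr : r + n < q)
    (t : R) :
    ∑ c : Fin q, (if r ≤ (c : ℕ) ∧ (c : ℕ) ≤ r + n then f.coeff (r + n - c) else 0) *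
      t ^ (q - 1 - (c : ℕ)) = t ^ (q - 1 - (r + n)) * f.eval t := by
  rw [Polynomial.eval_eq_sum_range' (Nat.lt_succ_of_le hf), Finset.mul_sum,
    Fin.sum_univ_eq_sum_range (fun c => (if r ≤ c ∧ c ≤ r + n then f.coeff (r + n - c) else 0) *
      t ^ (q - 1 - c))]
  symm
  refine Finset.sum_of_injOn (fun j => r + n - j) ?_ ?_ ?_ ?_
  · intro i hi j hj hij
    simp only [Finset.coe_range, Set.mem_Iio] at hi hj hij
    omega
  · intro j hj
    simp only [Finset.coe_range, Set.mem_Iio] at hj ⊢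
    omega
  · intro c _ hc
    rw [if_neg, zero_mul]
    rintro ⟨h1, h2⟩
    exact hc ⟨r + n - c, by simp; omega, by simp; omega⟩
  · intro j hj
    rw [Finset.mem_range] at hj
    rw [if_pos (by omega), mul_left_comm, ← pow_add]
    congr 2 <;> omega

theorem eval_subres_eq_zero {i n m : ℕ} {f g : Polynomial R} (hf : f.natDegree ≤ n)
    (hg : g.natDegree ≤ m) (hnm : 2 * i < n + m) {t : R} (hft : f.eval t = 0)
    (hgt : g.eval t = 0) : (subres i f n g m).eval t = 0 := by
  refine eval_detpol_eq_zero _ (by omega) _ t fun r => ?_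
  have hr := r.isLt
  by_cases h : (r : ℕ) < m - i
  · simp only [sylv, Matrix.of_apply, if_pos h]
    rw [sum_shifted_coeff hf (by omega), hft, mul_zero]
  · simp only [sylv, Matrix.of_apply, if_neg h]
    rw [sum_shifted_coeff hg (by omega), hgt, mul_zero]

theorem eval₂_subres_eq_zero (φ : R →+* S) {i n m : ℕ} {f g : Polynomial R} (hf : f.natDegree ≤ n)
    (hg : g.natDegree ≤ m) (hnm : 2 * i < n + m) {t : S} (hft : f.eval₂ φ t = 0)
    (hgt : g.eval₂ φ t = 0) : (subres i f n g m).eval₂ φ t = 0 := by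
  rw [← Polynomial.eval_map] at *
  rw [map_subres]
  exact eval_subres_eq_zero (Polynomial.natDegree_map_le.trans hf)
    (Polynomial.natDegree_map_le.trans hg) hnm hft hgt

/-- At a common root `t` of `f` and `g`, `sres₁ t + s₀ = 0`. -/
theorem sres_one_mul_add_eq_zero (φ : R →+* S) {n m : ℕ} {f g : Polynomial R}
    (hf : f.natDegree ≤ n) (hg : g.natDegree ≤ m) (hnm : 2 < n + m) {t : S}
    (hft : f.eval₂ φ t = 0) (hgt : g.eval₂ φ t = 0) :
    φ (sres 1 f n g m) * t + φ ((subres 1 f n g m).coeff 0) = 0 := by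
  have hdeg : (subres 1 f n g m).natDegree ≤ 1 := (natDegree_detpol_le _ _).trans (by omega)
  have := eval₂_subres_eq_zero φ hf hg (i := 1) (by omega) hft hgt
  rw [Polynomial.eq_X_add_C_of_natDegree_le_one hdeg] at this
  simpa [sres] using this

end Subresultants

/-! ### Values over an algebra of `P` and `Q` -/

section Values

variable {A : Type*} [CommRing A] [Algebra ℝ A] (X Y W : Polynomial ℝ) (d : ℝ)

theorem eval₂_inT (p : Fin 2 → A) (t : ℝ) (f : Polynomial ℝ) :
    (inT f).eval₂ (MvPolynomial.aeval p : _ →ₐ[ℝ] A).toRingHom (algebraMap ℝ A t) =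
      algebraMap ℝ A (f.eval t) := by
  rw [inT, Polynomial.eval₂_map]
  have : (MvPolynomial.aeval p : _ →ₐ[ℝ] A).toRingHom.comp MvPolynomial.C = algebraMap ℝ A := by
    ext a
    simp
  rw [this, Polynomial.eval₂_at_apply]

theorem eval₂_xy (p : Fin 2 → A) (t : A) (i : Fin 2) :
    (xy i).eval₂ (MvPolynomial.aeval p : _ →ₐ[ℝ] A).toRingHom t = p i := by
  simp [xy]

theorem eval₂_tildeP (p : Fin 2 → A) (t : ℝ) :
    (tildeP X Y W).eval₂ (MvPolynomial.aeval p : _ →ₐ[ℝ] A).toRingHom (algebraMap ℝ A t) =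
      algebraMap ℝ A ((velocity X W).eval t) *
        (algebraMap ℝ A (W.eval t) * p 0 - algebraMap ℝ A (X.eval t)) +
      algebraMap ℝ A ((velocity Y W).eval t) *
        (algebraMap ℝ A (W.eval t) * p 1 - algebraMap ℝ A (Y.eval t)) := by
  simp only [tildeP, Polynomial.eval₂_add, Polynomial.eval₂_mul, Polynomial.eval₂_sub, eval₂_inT,
    eval₂_xy]

theorem eval₂_tildeQ (p : Fin 2 → A) (t : ℝ) :
    (tildeQ X Y W d).eval₂ (MvPolynomial.aeval p : _ →ₐ[ℝ] A).toRingHom (algebraMap ℝ A t) =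
      (algebraMap ℝ A (W.eval t) * p 0 - algebraMap ℝ A (X.eval t)) ^ 2 +
      (algebraMap ℝ A (W.eval t) * p 1 - algebraMap ℝ A (Y.eval t)) ^ 2 -
      algebraMap ℝ A (d ^ 2 * W.eval t ^ 2) := by
  simp only [tildeQ, Polynomial.eval₂_add, Polynomial.eval₂_pow, Polynomial.eval₂_mul,
    Polynomial.eval₂_sub, eval₂_inT, eval₂_xy, Polynomial.eval_mul, Polynomial.eval_pow,
    Polynomial.eval_C]

theorem contentP_dvd :
    contentP X Y W ∣ velocity X W * W ∧ contentP X Y W ∣ velocity Y W * W ∧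
      contentP X Y W ∣ velocity X W * X + velocity Y W * Y :=
  have h := EuclideanDomain.gcd_dvd_right (velocity X W * W)
    (EuclideanDomain.gcd (velocity Y W * W) (velocity X W * X + velocity Y W * Y))
  ⟨EuclideanDomain.gcd_dvd_left _ _, h.trans (EuclideanDomain.gcd_dvd_left _ _),
    h.trans (EuclideanDomain.gcd_dvd_right _ _)⟩

theorem contentQ_dvd :
    contentQ X Y W d ∣ W ^ 2 ∧ contentQ X Y W d ∣ W * X ∧ contentQ X Y W d ∣ W * Y ∧
      contentQ X Y W d ∣ X ^ 2 + Y ^ 2 - Polynomial.C (d ^ 2) * W ^ 2 :=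
  have h := EuclideanDomain.gcd_dvd_right (W ^ 2) (EuclideanDomain.gcd (W * X)
    (EuclideanDomain.gcd (W * Y) (X ^ 2 + Y ^ 2 - Polynomial.C (d ^ 2) * W ^ 2)))
  have h' := h.trans (EuclideanDomain.gcd_dvd_right _ _)
  ⟨EuclideanDomain.gcd_dvd_left _ _, h.trans (EuclideanDomain.gcd_dvd_left _ _),
    h'.trans (EuclideanDomain.gcd_dvd_left _ _), h'.trans (EuclideanDomain.gcd_dvd_right _ _)⟩

variable {X Y W d}

theorem eval_contentP_ne_zero {t : ℝ} (hW : W.eval t ≠ 0)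
    (hUV : ((velocity X W).eval t, (velocity Y W).eval t) ≠ (0, 0)) :
    (contentP X Y W).eval t ≠ 0 := by
  intro h
  have h1 := Polynomial.eval_eq_zero_of_dvd_of_eval_eq_zero (contentP_dvd X Y W).1 h
  have h2 := Polynomial.eval_eq_zero_of_dvd_of_eval_eq_zero (contentP_dvd X Y W).2.1 h
  rw [Polynomial.eval_mul, mul_eq_zero, or_iff_left hW] at h1 h2
  exact hUV (Prod.ext h1 h2)

theorem eval_contentQ_ne_zero {t : ℝ} (hW : W.eval t ≠ 0) : (contentQ X Y W d).eval t ≠ 0 := by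
  intro h
  have h1 := Polynomial.eval_eq_zero_of_dvd_of_eval_eq_zero (contentQ_dvd X Y W d).1 h
  simp [hW] at h1

theorem GeneratedByRegular.velocity_sq_pos {p : ℝ × ℝ} {t : ℝ}
    (h : GeneratedByRegular X Y W d p t) :
    0 < (velocity X W).eval t ^ 2 + (velocity Y W).eval t ^ 2 := by
  by_contra! hle
  exact h.2.1 (Prod.ext (by nlinarith [sq_nonneg ((velocity Y W).eval t)])
    (by nlinarith [sq_nonneg ((velocity X W).eval t)]))

theorem GeneratedByRegular.exists_sign {p : ℝ × ℝ} {t : ℝ} (h : GeneratedByRegular X Y W d p t) :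
    ∃ s : ℝ, s ^ 2 = 1 ∧ p = offsetPoint X Y W d s t := by
  rcases h.2.2 with hp | hp
  exacts [⟨1, by norm_num, hp⟩, ⟨-1, by norm_num, hp⟩]

/-- A point generated by `t` is at distance `d` from `φ(t)`, in the normal direction. -/
theorem GeneratedByRegular.exists_sub_eq {p : ℝ × ℝ} {t : ℝ} (h : GeneratedByRegular X Y W d p t) :
    ∃ k : ℝ, W.eval t * p.1 - X.eval t = k * (velocity Y W).eval t ∧
      W.eval t * p.2 - Y.eval t = -k * (velocity X W).eval t ∧
      k ^ 2 * ((velocity X W).eval t ^ 2 + (velocity Y W).eval t ^ 2) = d ^ 2 * W.eval t ^ 2 := by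
  have hW := h.1
  have hpos := h.velocity_sq_pos
  obtain ⟨s, hs, rfl⟩ := h.exists_sign
  have hr := Real.sqrt_pos.2 hpos
  have hr2 := Real.sq_sqrt hpos.le
  simp only [offsetPoint]
  set r := √((velocity X W).eval t ^ 2 + (velocity Y W).eval t ^ 2)
  refine ⟨s * d * W.eval t / r, by field_simp; ring, by field_simp; ring, ?_⟩
  rw [← hr2]
  field_simp
  rw [hs, one_mul]

theorem GeneratedByRegular.eval₂_polyP {p : ℝ × ℝ} {t : ℝ} (h : GeneratedByRegular X Y W d p t) :
    (polyP X Y W).eval₂ (MvPolynomial.aeval ![p.1, p.2] : _ →ₐ[ℝ] ℝ).toRingHom t = 0 := by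
  obtain ⟨k, h1, h2, -⟩ := h.exists_sub_eq
  have := eval₂_tildeP X Y W ![p.1, p.2] t
  rw [tildeP_eq, Polynomial.eval₂_mul, eval₂_inT] at this
  simp only [Algebra.algebraMap_self, RingHom.id_apply, Matrix.cons_val_zero, Matrix.cons_val_one,
    h1, h2] at this
  refine (mul_eq_zero.1 (this.trans ?_)).resolve_left (eval_contentP_ne_zero h.1 h.2.1)
  ring

theorem GeneratedByRegular.eval₂_polyQ {p : ℝ × ℝ} {t : ℝ} (h : GeneratedByRegular X Y W d p t) :
    (polyQ X Y W d).eval₂ (MvPolynomial.aeval ![p.1, p.2] : _ →ₐ[ℝ] ℝ).toRingHom t = 0 := by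
  obtain ⟨k, h1, h2, h3⟩ := h.exists_sub_eq
  have := eval₂_tildeQ X Y W d ![p.1, p.2] t
  rw [tildeQ_eq, Polynomial.eval₂_mul, eval₂_inT] at this
  simp only [Algebra.algebraMap_self, RingHom.id_apply, Matrix.cons_val_zero, Matrix.cons_val_one,
    h1, h2] at this
  refine (mul_eq_zero.1 (this.trans ?_)).resolve_left (eval_contentQ_ne_zero h.1)
  linear_combination h3

/-! ### The degrees of `P` and `Q` in `t` -/

theorem velocity_eq_zero_of_eq_C_mul {b : ℝ} (h : X = Polynomial.C b * W) : velocity X W = 0 := by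
  simp only [h, velocity, Polynomial.derivative_mul, Polynomial.derivative_C]
  ring

/-- If `P` does not depend on `t`, the normal lines of the curve are all the same line. The curve
lies on it, so its velocity is both parallel and orthogonal to it, hence zero. -/
theorem natDegree_polyP_pos (hW : W ≠ 0) (hUV : velocity X W ≠ 0 ∨ velocity Y W ≠ 0) :
    0 < (polyP X Y W).natDegree := by
  by_contra! h0
  obtain ⟨hd1, hd2, hd3⟩ := contentP_dvd X Y W
  have hc : contentP X Y W ≠ 0 := by
    intro hc
    rw [hc, zero_dvd_iff, mul_eq_zero, or_iff_left hW] at hd1 hd2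
    exact hUV.elim (· hd1) (· hd2)
  have e1 := EuclideanDomain.mul_div_cancel' hc hd1
  have e2 := EuclideanDomain.mul_div_cancel' hc hd2
  have e3 := EuclideanDomain.mul_div_cancel' hc hd3
  have hcoeff (k : ℕ) (hk : 0 < k) := Polynomial.coeff_eq_zero_of_natDegree_lt (h0.trans_lt hk)
  simp only [polyP, inT, xy, Polynomial.coeff_add, Polynomial.coeff_sub, Polynomial.coeff_mul_C,
    Polynomial.coeff_map] at hcoeff
  generalize velocity X W * W / contentP X Y W = A at *
  generalize velocity Y W * W / contentP X Y W = B at *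
  generalize (velocity X W * X + velocity Y W * Y) / contentP X Y W = E at *
  generalize contentP X Y W = c at *
  have hk (k : ℕ) (hk : 0 < k) : A.coeff k = 0 ∧ B.coeff k = 0 ∧ E.coeff k = 0 := by
    have h00 := congrArg (MvPolynomial.eval ![0, 0]) (hcoeff k hk)
    have h10 := congrArg (MvPolynomial.eval ![1, 0]) (hcoeff k hk)
    have h01 := congrArg (MvPolynomial.eval ![0, 1]) (hcoeff k hk)
    simp at h00 h10 h01
    refine ⟨?_, ?_, ?_⟩ <;> linarith
  obtain ⟨a, rfl⟩ : ∃ a, A = Polynomial.C a :=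
    ⟨_, Polynomial.eq_C_of_natDegree_le_zero (Polynomial.natDegree_le_iff_coeff_eq_zero.2
      fun k h => (hk k h).1)⟩
  obtain ⟨b, rfl⟩ : ∃ b, B = Polynomial.C b :=
    ⟨_, Polynomial.eq_C_of_natDegree_le_zero (Polynomial.natDegree_le_iff_coeff_eq_zero.2
      fun k h => (hk k h).2.1)⟩
  obtain ⟨e, rfl⟩ : ∃ e, E = Polynomial.C e :=
    ⟨_, Polynomial.eq_C_of_natDegree_le_zero (Polynomial.natDegree_le_iff_coeff_eq_zero.2
      fun k h => (hk k h).2.2)⟩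
  have hline : Polynomial.C a * X + Polynomial.C b * Y = Polynomial.C e * W :=
    mul_left_cancel₀ hc (by linear_combination X * e1 + Y * e2 - W * e3)
  have hvel : Polynomial.C a * velocity X W + Polynomial.C b * velocity Y W = 0 := by
    have := congrArg (fun f => velocity f W) hline
    simp only [velocity, Polynomial.derivative_add, Polynomial.derivative_mul,
      Polynomial.derivative_C] at this ⊢
    linear_combination this
  have hab : Polynomial.C (a ^ 2 + b ^ 2) = 0 := by
    refine mul_left_cancel₀ hc ?_
    simp only [Polynomial.C_add, Polynomial.C_pow]
    linear_combination Polynomial.C a * e1 + Polynomial.C b * e2 + W * hvel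
  rw [Polynomial.C_eq_zero] at hab
  have ha : a = 0 := by nlinarith [sq_nonneg b]
  have hb : b = 0 := by nlinarith [sq_nonneg a]
  rw [ha, Polynomial.C_0, mul_zero, eq_comm, mul_eq_zero, or_iff_left hW] at e1
  rw [hb, Polynomial.C_0, mul_zero, eq_comm, mul_eq_zero, or_iff_left hW] at e2
  exact hUV.elim (· e1) (· e2)

/-- Over the reals, `B² + C² - d² A² = A E` with all of degree at most one forces `B` and `C` to be
multiples of `A`. -/
theorem exists_eq_C_mul_of_natDegree_le_one {A B C E : Polynomial ℝ} (hA0 : A ≠ 0)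
    (hA : A.natDegree ≤ 1) (hB : B.natDegree ≤ 1) (hC : C.natDegree ≤ 1) (hE : E.natDegree ≤ 1)
    (h : B ^ 2 + C ^ 2 - Polynomial.C (d ^ 2) * A ^ 2 = A * E) :
    (∃ b, B = Polynomial.C b * A) ∧ ∃ b, C = Polynomial.C b * A := by
  obtain ⟨a₁, a₀, rfl⟩ := Polynomial.exists_eq_X_add_C_of_natDegree_le_one hA
  obtain ⟨b₁, b₀, rfl⟩ := Polynomial.exists_eq_X_add_C_of_natDegree_le_one hB
  obtain ⟨c₁, c₀, rfl⟩ := Polynomial.exists_eq_X_add_C_of_natDegree_le_one hC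
  obtain ⟨e₁, e₀, rfl⟩ := Polynomial.exists_eq_X_add_C_of_natDegree_le_one hE
  have hev (t : ℝ) := congrArg (Polynomial.eval t) h
  simp only [Polynomial.eval_add, Polynomial.eval_sub, Polynomial.eval_mul, Polynomial.eval_pow,
    Polynomial.eval_C, Polynomial.eval_X] at hev
  by_cases ha : a₁ = 0
  · -- `A` is constant, and the coefficient of `t²` is `b₁² + c₁² = 0`
    subst ha
    have ha₀ : a₀ ≠ 0 := by
      rintro rfl
      simp at hA0
    have h2 : b₁ ^ 2 + c₁ ^ 2 = 0 := by
      linear_combination (hev 1 + hev (-1)) / 2 - hev 0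
    obtain rfl : b₁ = 0 := by nlinarith [sq_nonneg c₁]
    obtain rfl : c₁ = 0 := by simpa using h2
    refine ⟨⟨b₀ / a₀, ?_⟩, ⟨c₀ / a₀, ?_⟩⟩ <;> simp [← Polynomial.C_mul, ha₀]
  · -- at the root of `A`, both `B` and `C` vanish
    have hr := hev (-a₀ / a₁)
    have hz : a₁ * (-a₀ / a₁) + a₀ = 0 := by field_simp; ring
    rw [hz] at hr
    have h1 : b₁ * (-a₀ / a₁) + b₀ = 0 := by
      nlinarith [sq_nonneg (c₁ * (-a₀ / a₁) + c₀), sq_nonneg (b₁ * (-a₀ / a₁) + b₀)]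
    have h2 : c₁ * (-a₀ / a₁) + c₀ = 0 := by
      nlinarith [sq_nonneg (c₁ * (-a₀ / a₁) + c₀), sq_nonneg (b₁ * (-a₀ / a₁) + b₀)]
    have h1' : b₀ = b₁ / a₁ * a₀ := by linear_combination h1
    have h2' : c₀ = c₁ / a₁ * a₀ := by linear_combination h2
    have key (b₀ b₁ : ℝ) (h : b₀ = b₁ / a₁ * a₀) :
        Polynomial.C b₁ * Polynomial.X + Polynomial.C b₀ =
          Polynomial.C (b₁ / a₁) * (Polynomial.C a₁ * Polynomial.X + Polynomial.C a₀) := by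
      rw [mul_add, ← mul_assoc, ← Polynomial.C_mul, ← Polynomial.C_mul, div_mul_cancel₀ _ ha, h]
    exact ⟨⟨_, key _ _ h1'⟩, ⟨_, key _ _ h2'⟩⟩

/-- If `Q` has degree at most one in `t`, then `X / W = B / A` and `Y / W = C / A` with
`A, B, C, E` of degree at most one as in `exists_eq_C_mul_of_natDegree_le_one`, so `X / W` and
`Y / W` are constant. -/
theorem two_le_natDegree_polyQ (hW : W ≠ 0) (hUV : velocity X W ≠ 0 ∨ velocity Y W ≠ 0) :
    2 ≤ (polyQ X Y W d).natDegree := by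
  by_contra! h0
  obtain ⟨hd1, hd2, hd3, hd4⟩ := contentQ_dvd X Y W d
  have hc : contentQ X Y W d ≠ 0 := by
    intro hc
    rw [hc, zero_dvd_iff] at hd1
    exact hW (pow_eq_zero_iff two_ne_zero |>.1 hd1)
  have e1 := EuclideanDomain.mul_div_cancel' hc hd1
  have e2 := EuclideanDomain.mul_div_cancel' hc hd2
  have e3 := EuclideanDomain.mul_div_cancel' hc hd3
  have e4 := EuclideanDomain.mul_div_cancel' hc hd4
  have hcoeff (k : ℕ) (hk : 1 < k) :=
    Polynomial.coeff_eq_zero_of_natDegree_lt ((Nat.le_of_lt_succ h0).trans_lt hk)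
  have hrw : polyQ X Y W d = inT (W ^ 2 / contentQ X Y W d) *
      Polynomial.C (MvPolynomial.X 0 ^ 2 + MvPolynomial.X 1 ^ 2) -
      inT (W * X / contentQ X Y W d) * Polynomial.C (2 * MvPolynomial.X 0) -
      inT (W * Y / contentQ X Y W d) * Polynomial.C (2 * MvPolynomial.X 1) +
      inT ((X ^ 2 + Y ^ 2 - Polynomial.C (d ^ 2) * W ^ 2) / contentQ X Y W d) := by
    simp only [polyQ, xy, map_add, map_mul, map_pow, Polynomial.C_ofNat]
    ring
  simp only [hrw, inT, Polynomial.coeff_add, Polynomial.coeff_sub, Polynomial.coeff_mul_C,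
    Polynomial.coeff_map] at hcoeff
  clear hrw h0
  generalize W ^ 2 / contentQ X Y W d = A at *
  generalize W * X / contentQ X Y W d = B at *
  generalize W * Y / contentQ X Y W d = C at *
  generalize (X ^ 2 + Y ^ 2 - Polynomial.C (d ^ 2) * W ^ 2) / contentQ X Y W d = E at *
  generalize contentQ X Y W d = c at *
  have hk (k : ℕ) (hk : 1 < k) :
      A.coeff k = 0 ∧ B.coeff k = 0 ∧ C.coeff k = 0 ∧ E.coeff k = 0 := by
    have h00 := congrArg (MvPolynomial.eval ![0, 0]) (hcoeff k hk)
    have h10 := congrArg (MvPolynomial.eval ![1, 0]) (hcoeff k hk)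
    have h20 := congrArg (MvPolynomial.eval ![-1, 0]) (hcoeff k hk)
    have h01 := congrArg (MvPolynomial.eval ![0, 1]) (hcoeff k hk)
    simp at h00 h10 h20 h01
    refine ⟨?_, ?_, ?_, ?_⟩ <;> linarith
  have hA0 : A ≠ 0 := by
    rintro rfl
    rw [mul_zero] at e1
    exact hW (pow_eq_zero_iff two_ne_zero |>.1 e1.symm)
  have h : B ^ 2 + C ^ 2 - Polynomial.C (d ^ 2) * A ^ 2 = A * E := by
    refine mul_left_cancel₀ (pow_ne_zero 2 hc) ?_
    linear_combination (c * B + W * X) * e2 + (c * C + W * Y) * e3 -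
      Polynomial.C (d ^ 2) * (c * A + W ^ 2) * e1 - c * E * e1 - W ^ 2 * e4
  have hdeg {F : Polynomial ℝ} (hF : ∀ k, 1 < k → F.coeff k = 0) : F.natDegree ≤ 1 :=
    Polynomial.natDegree_le_iff_coeff_eq_zero.2 hF
  obtain ⟨⟨b, rfl⟩, ⟨b', rfl⟩⟩ := exists_eq_C_mul_of_natDegree_le_one hA0
    (hdeg fun k h => (hk k h).1) (hdeg fun k h => (hk k h).2.1)
    (hdeg fun k h => (hk k h).2.2.1) (hdeg fun k h => (hk k h).2.2.2) h
  refine hUV.elim (· (velocity_eq_zero_of_eq_C_mul (b := b) ?_))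
    (· (velocity_eq_zero_of_eq_C_mul (b := b') ?_))
  · exact mul_left_cancel₀ hW (by linear_combination -e2 + Polynomial.C b * e1)
  · exact mul_left_cancel₀ hW (by linear_combination -e3 + Polynomial.C b' * e1)

end Values

/-! ### First-order vanishing at singular points -/

/-- A real polynomial that vanishes at all points of `T` vanishes to second order at the singular
points of the Zariski closure of `T`. -/
theorem eval_eq_zero_and_pderiv_eq_zero_of_isSingularity {T : Set (ℝ × ℝ)} {x y : ℝ}
    (hS : IsSingularity (zariskiClosure (toC '' T)) (toC (x, y))) {G : MvPolynomial (Fin 2) ℝ}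
    (hG : ∀ p ∈ T, MvPolynomial.eval ![p.1, p.2] G = 0) :
    MvPolynomial.eval ![x, y] G = 0 ∧ ∀ i, MvPolynomial.eval ![x, y] (.pderiv i G) = 0 := by
  obtain ⟨hmem, F, hF, hpF⟩ := hS
  have htoC (p : ℝ × ℝ) (H : MvPolynomial (Fin 2) ℝ) :
      MvPolynomial.eval (toC p) (H.map Complex.ofRealHom) =
        ((MvPolynomial.eval ![p.1, p.2] H : ℝ) : ℂ) := by
    have : toC p = Complex.ofRealHom ∘ ![p.1, p.2] := by
      ext i
      fin_cases i <;> rfl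
    rw [MvPolynomial.eval_map, this, ← MvPolynomial.eval₂_comp]
    rfl
  have hGT : G.map Complex.ofRealHom ∈ MvPolynomial.vanishingIdeal ℂ (toC '' T) := by
    rw [MvPolynomial.mem_vanishingIdeal_iff]
    rintro _ ⟨p, hp, rfl⟩
    have := htoC p G
    rw [hG p hp, Complex.ofReal_zero] at this
    simpa [MvPolynomial.aeval_eq_eval] using this
  have hGD : G.map Complex.ofRealHom ∈
      MvPolynomial.vanishingIdeal ℂ (zariskiClosure (toC '' T)) := by
    rw [MvPolynomial.mem_vanishingIdeal_iff]
    intro z hz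
    exact hz _ hGT
  have hF0 : MvPolynomial.eval (toC (x, y)) F = 0 := by
    have : F ∈ MvPolynomial.vanishingIdeal ℂ (zariskiClosure (toC '' T)) := by
      rw [hF]
      exact Ideal.mem_span_singleton_self F
    simpa [MvPolynomial.aeval_eq_eval] using
      (MvPolynomial.mem_vanishingIdeal_iff.1 this) _ hmem
  rw [hF, Ideal.mem_span_singleton] at hGD
  obtain ⟨H, hH⟩ := hGD
  constructor
  · have := htoC (x, y) G
    rw [hH, map_mul, hF0, zero_mul] at this
    exact_mod_cast this.symm
  · intro i
    have := htoC (x, y) (.pderiv i G)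
    rw [← MvPolynomial.pderiv_map, hH, Derivation.leibniz, map_add, smul_eq_mul, smul_eq_mul,
      map_mul, map_mul, hF0, hpF, zero_mul, mul_zero, add_zero] at this
    exact_mod_cast this.symm

/-- Evaluation at `a + ε v` over the dual numbers. -/
theorem aeval_dualNumber (a v : Fin 2 → ℝ) (f : MvPolynomial (Fin 2) ℝ) :
    (MvPolynomial.aeval fun i => (TrivSqZeroExt.inl (a i) + TrivSqZeroExt.inr (v i) :
      DualNumber ℝ)) f = TrivSqZeroExt.inl (MvPolynomial.eval a f) +
        TrivSqZeroExt.inr (∑ i, v i * MvPolynomial.eval a (.pderiv i f)) := by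
  induction f using MvPolynomial.induction_on with
  | C r =>
    ext <;> simp [TrivSqZeroExt.algebraMap_eq_inl]
  | add p q hp hq =>
    rw [map_add, hp, hq]
    ext <;> simp
    ring
  | mul_X p j hp =>
    rw [map_mul, hp, MvPolynomial.aeval_X]
    ext
    · simp
    · fin_cases j <;> simp [MvPolynomial.pderiv_X] <;> ring

/-! ### The principal subresultant at a generated singular point -/

/-- Clearing denominators in `f(-s₀ / s₁)`. -/
theorem eval₂_eq_zero_of_scaleRoots {R A : Type*} [CommRing R] [CommRing A] (φ : R →+* A)
    {f : Polynomial R} {s₀ s₁ : R} {t : A} (hs : IsUnit (φ s₁)) (ht : φ s₁ * t + φ s₀ = 0)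
    (h : φ ((f.scaleRoots s₁).eval (-s₀)) = 0) : f.eval₂ φ t = 0 := by
  rw [← Polynomial.eval₂_at_apply, map_neg, ← eq_neg_of_add_eq_zero_left ht,
    Polynomial.scaleRoots_eval₂_mul] at h
  exact (hs.pow _).mul_right_eq_zero.1 h

variable {X Y W : Polynomial ℝ} {d : ℝ}

theorem eval_sresPQ_eq_zero (hd : d ≠ 0) {x₀ y₀ t₀ : ℝ}
    (hsing : IsSingularity (offset X Y W d) (toC (x₀, y₀)))
    (hgen : GeneratedByRegular X Y W d (x₀, y₀) t₀) :
    MvPolynomial.eval ![x₀, y₀] (sresPQ X Y W d) = 0 := by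
  by_contra hne
  have hW : W ≠ 0 := by
    rintro rfl
    exact hgen.1 Polynomial.eval_zero
  have hUV : velocity X W ≠ 0 ∨ velocity Y W ≠ 0 := by
    by_contra! h
    exact hgen.2.1 (by simp [h.1, h.2])
  have hnm : 2 < (polyP X Y W).natDegree + (polyQ X Y W d).natDegree := by
    have := natDegree_polyP_pos hW hUV
    have := two_le_natDegree_polyQ (d := d) hW hUV
    omega
  set s₁ := sresPQ X Y W d
  set s₀ := (subres 1 (polyP X Y W) (polyP X Y W).natDegree (polyQ X Y W d)
    (polyQ X Y W d).natDegree).coeff 0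
  have hroot {p : ℝ × ℝ} {t : ℝ} (h : GeneratedByRegular X Y W d p t) :
      MvPolynomial.eval ![p.1, p.2] s₁ * t + MvPolynomial.eval ![p.1, p.2] s₀ = 0 :=
    sres_one_mul_add_eq_zero _ le_rfl le_rfl hnm h.eval₂_polyP h.eval₂_polyQ
  -- the elimination of `t` from a polynomial that vanishes at all `(φ_d(t), t)`
  have helim (f : Polynomial (MvPolynomial (Fin 2) ℝ))
      (hf : ∀ p t, GeneratedByRegular X Y W d p t → f.eval₂ (MvPolynomial.eval ![p.1, p.2]) t = 0) :
      MvPolynomial.eval ![x₀, y₀] ((f.scaleRoots s₁).eval (-s₀)) = 0 ∧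
        ∀ i, MvPolynomial.eval ![x₀, y₀] (.pderiv i ((f.scaleRoots s₁).eval (-s₀))) = 0 := by
    refine eval_eq_zero_and_pderiv_eq_zero_of_isSingularity hsing ?_
    rintro p ⟨t, ht⟩
    rw [← Polynomial.eval₂_at_apply, map_neg, ← eq_neg_of_add_eq_zero_left (hroot ht),
      Polynomial.scaleRoots_eval₂_mul, hf p t ht, mul_zero]
  have hP := helim (polyP X Y W) fun p t h => h.eval₂_polyP
  have hQ := helim (polyQ X Y W d) fun p t h => h.eval₂_polyQ
  -- a nonzero direction in which `s₁ t₀ + s₀` is constant to first order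
  obtain ⟨v, hv, hvs⟩ : ∃ v : Fin 2 → ℝ, v ≠ 0 ∧ ∑ i, v i * MvPolynomial.eval ![x₀, y₀]
      (.pderiv i (s₁ * MvPolynomial.C t₀ + s₀)) = 0 := by
    simp only [Fin.sum_univ_two]
    generalize MvPolynomial.eval ![x₀, y₀] (.pderiv 0 (s₁ * MvPolynomial.C t₀ + s₀)) = a
    generalize MvPolynomial.eval ![x₀, y₀] (.pderiv 1 (s₁ * MvPolynomial.C t₀ + s₀)) = b
    by_cases ha : a = 0
    · exact ⟨![1, 0], fun h => one_ne_zero (congrFun h 0), by simp [ha]⟩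
    · exact ⟨![b, -a], fun h => ha (neg_eq_zero.1 (congrFun h 1)), by simp; ring⟩
  let q : Fin 2 → DualNumber ℝ := fun i =>
    TrivSqZeroExt.inl (![x₀, y₀] i) + TrivSqZeroExt.inr (v i)
  let ψ : MvPolynomial (Fin 2) ℝ →ₐ[ℝ] DualNumber ℝ := MvPolynomial.aeval q
  have hψ (f : MvPolynomial (Fin 2) ℝ) := aeval_dualNumber ![x₀, y₀] v f
  have hunit : IsUnit (ψ s₁) := by
    rw [TrivSqZeroExt.isUnit_iff_isUnit_fst, hψ]
    simpa using hne
  have ht : ψ s₁ * algebraMap ℝ _ t₀ + ψ s₀ = 0 := by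
    have h1 := hψ (s₁ * MvPolynomial.C t₀ + s₀)
    have h2 := hroot hgen
    rw [hvs, map_add, map_mul, MvPolynomial.aeval_C] at h1
    refine h1.trans ?_
    rw [TrivSqZeroExt.inr_zero, add_zero, map_add, map_mul, MvPolynomial.eval_C]
    exact (congrArg TrivSqZeroExt.inl h2).trans (TrivSqZeroExt.inl_zero _)
  have hP' : (polyP X Y W).eval₂ ψ.toRingHom (algebraMap ℝ _ t₀) = 0 :=
    eval₂_eq_zero_of_scaleRoots ψ.toRingHom hunit ht
      ((hψ _).trans (by simp only [hP.1, hP.2]; simp))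
  have hQ' : (polyQ X Y W d).eval₂ ψ.toRingHom (algebraMap ℝ _ t₀) = 0 :=
    eval₂_eq_zero_of_scaleRoots ψ.toRingHom hunit ht
      ((hψ _).trans (by simp only [hQ.1, hQ.2]; simp))
  have hP'' := eval₂_tildeP X Y W q t₀
  have hQ'' := eval₂_tildeQ X Y W d q t₀
  rw [tildeP_eq, Polynomial.eval₂_mul, hP', mul_zero] at hP''
  rw [tildeQ_eq, Polynomial.eval₂_mul, hQ', mul_zero] at hQ''
  -- the coefficients of `ε`
  have hP₁ := congrArg TrivSqZeroExt.snd hP''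
  have hQ₁ := congrArg TrivSqZeroExt.snd hQ''
  simp [q, pow_two, TrivSqZeroExt.algebraMap_eq_inl] at hP₁ hQ₁
  have hW₀ := hgen.1
  have hab := hgen.velocity_sq_pos.ne'
  obtain ⟨k, h1, h2, h3⟩ := hgen.exists_sub_eq
  dsimp only at h1 h2
  rw [h1, h2] at hQ₁
  generalize (velocity X W).eval t₀ = a at *
  generalize (velocity Y W).eval t₀ = b at *
  generalize W.eval t₀ = w at *
  have hk : k * w ≠ 0 := by
    refine mul_ne_zero ?_ hW₀
    rintro rfl
    rw [zero_pow two_ne_zero, zero_mul, eq_comm, ← mul_pow] at h3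
    exact mul_ne_zero hd hW₀ (pow_eq_zero_iff two_ne_zero |>.1 h3)
  have hn : a * v 0 + b * v 1 = 0 := mul_left_cancel₀ hW₀ (by linear_combination -hP₁)
  have hτ : b * v 0 - a * v 1 = 0 := mul_left_cancel₀ hk (by linear_combination -hQ₁ / 2)
  refine hv (funext fun i => mul_left_cancel₀ hab ?_)
  fin_cases i
  · simp only [Fin.zero_eta, Pi.zero_apply]
    linear_combination a * hn + b * hτ
  · simp only [Fin.mk_one, Pi.zero_apply]
    linear_combination b * hn - a * hτ

end OffsetCurve

theorem mainTheorem2 (X Y W : Polynomial ℝ) (d : ℝ) (hd : 0 < d)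
    (hgcd : ∀ q : Polynomial ℝ, q ∣ X → q ∣ Y → q ∣ W → IsUnit q)
    (hproper : OffsetCurve.IsProper X Y W)
    (hirr : OffsetCurve.IsIrreducibleCurve (OffsetCurve.offset X Y W d))
    (x₀ y₀ t₀ : ℝ)
    (hsing : OffsetCurve.IsSingularity (OffsetCurve.offset X Y W d) (OffsetCurve.toC (x₀, y₀)))
    (hiso : OffsetCurve.IsNonIsolated (OffsetCurve.offset X Y W d) (x₀, y₀))
    (hgen : OffsetCurve.GeneratedByRegular X Y W d (x₀, y₀) t₀) :
    ∃ α₀ : ℝ,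
      α₀ ^ 2 = (OffsetCurve.hatU X Y W).eval t₀ ^ 2 + (OffsetCurve.hatV X Y W).eval t₀ ^ 2 ∧
      x₀ = OffsetCurve.xMap X Y W d t₀ α₀ ∧ y₀ = OffsetCurve.yMap X Y W d t₀ α₀ ∧
      MvPolynomial.eval
        ![OffsetCurve.xMap X Y W d t₀ α₀, OffsetCurve.yMap X Y W d t₀ α₀]
        (OffsetCurve.sresPQ X Y W d) = 0 := by
  have hW := hgen.1
  have hUV := hgen.2.1
  obtain ⟨s, hs, hp⟩ := hgen.exists_sign
  have hx := congrArg Prod.fst hp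
  have hy := congrArg Prod.snd hp
  simp only [OffsetCurve.offsetPoint] at hx hy
  have hg : EuclideanDomain.gcd (OffsetCurve.velocity X W) (OffsetCurve.velocity Y W) ≠ 0 := by
    intro hg
    rw [EuclideanDomain.gcd_eq_zero_iff] at hg
    exact hUV (by simp [hg.1, hg.2])
  have hU := congrArg (Polynomial.eval t₀) (EuclideanDomain.mul_div_cancel' hg
    (EuclideanDomain.gcd_dvd_left (OffsetCurve.velocity X W) (OffsetCurve.velocity Y W)))
  have hV := congrArg (Polynomial.eval t₀) (EuclideanDomain.mul_div_cancel' hg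
    (EuclideanDomain.gcd_dvd_right (OffsetCurve.velocity X W) (OffsetCurve.velocity Y W)))
  rw [Polynomial.eval_mul] at hU hV
  set g := (EuclideanDomain.gcd (OffsetCurve.velocity X W) (OffsetCurve.velocity Y W)).eval t₀
  change g * (OffsetCurve.hatU X Y W).eval t₀ = _ at hU
  change g * (OffsetCurve.hatV X Y W).eval t₀ = _ at hV
  have hg₀ : g ≠ 0 := by
    intro hg₀
    rw [hg₀, zero_mul] at hU hV
    exact hUV (Prod.ext hU.symm hV.symm)
  have hpos := hgen.velocity_sq_pos
  have hr := Real.sqrt_pos.2 hpos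
  have hr2 := Real.sq_sqrt hpos.le
  set r := √((OffsetCurve.velocity X W).eval t₀ ^ 2 + (OffsetCurve.velocity Y W).eval t₀ ^ 2)
  rw [← hU] at hr2 hy
  rw [← hV] at hr2 hx
  have hs₀ : s ≠ 0 := by
    rintro rfl
    norm_num at hs
  -- the sign of `α₀` is that of `s` corrected by the sign of the gcd of `U` and `V` at `t₀`
  have hx' : x₀ = OffsetCurve.xMap X Y W d t₀ (s * r / g) := by
    rw [hx, OffsetCurve.xMap]
    field_simp
    linear_combination W.eval t₀ * d * g * (OffsetCurve.hatV X Y W).eval t₀ * hs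
  have hy' : y₀ = OffsetCurve.yMap X Y W d t₀ (s * r / g) := by
    rw [hy, OffsetCurve.yMap]
    field_simp
    linear_combination -W.eval t₀ * d * g * (OffsetCurve.hatU X Y W).eval t₀ * hs
  refine ⟨s * r / g, ?_, hx', hy', ?_⟩
  · rw [div_pow, mul_pow, hs, hr2]
    field_simp
  · rw [← hx', ← hy']
    exact OffsetCurve.eval_sresPQ_eq_zero hd.ne' hsing hgen
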